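/- Let $\mathcal H$ be a separable, nontrivial complex Hilbert space. For a measurable space $(\Omega,\Sigma)$, an observable on $\Sigma$ is a normalized positive operator valued measure $\mathsf A:\Sigma\to\mathcal L(\mathcal H)$: each $\mathsf A(X)$ is a positive operator, $\mathsf A(\Omega)=I$, and $\mathsf A$ is weakly $\sigma$-additive. Let $\mathcal O(\Sigma,\mathcal H)$ be the convex set of these observables. An observable $\mathsf A\in\mathcal O(\Sigma,\mathcal H)$ is called extreme if it is an extreme point of $\mathcal O(\Sigma,\mathcal H)$. It is called discrete if there is a finite or countably infinite set $\Xi\subseteq\Omega$ such that $\mathsf A(X)=0$ for every $X\in\Sigma$ with $\sum_{x\in\Xi}\delta_x(X)=0$, where $\delta_x$ is the Dirac measure at $x$. Let $(\Omega,\Sigma)$ and $(\Omega',\Sigma')$ be arbitrary measurable spaces, let $\mathsf A\in\mathcal O(\Sigma,\mathcal H)$ be discrete and extreme, and let $\mathsf B\in\mathcal O(\Sigma',\mathcal H)$ be arbitrary. Then $\mathsf A$ and $\mathsf B$ are coexistent if and only if they are jointly measurable. Here $\mathsf A$ and $\mathsf B$ are coexistent if there are a measurable space $(\overline\Omega,\overline\Sigma)$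 and an observable $\mathsf M\in\mathcal O(\overline\Sigma,\mathcal H)$ such that $$\{\mathsf A(X): X\in\Sigma\}\cup\{\mathsf B(Y): Y\in\Sigma'\}\subseteq\{\mathsf M(Z): Z\in\overline\Sigma\},$$ and they are jointly measurable if there is an observable $\mathsf N\in\mathcal O(\Sigma\otimes\Sigma',\mathcal H)$ on the product $\sigma$-algebra such that $\mathsf N(X\times\Omega')=\mathsf A(X)$ for all $X\in\Sigma$ and $\mathsf N(\Omega\times Y)=\mathsf B(Y)$ for all $Y\in\Sigma'$. -/

import Mathlib

open MeasureTheory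

universe u v w x

namespace QuantumObservable

/-- `IsObservable A` says that `A` is a quantum observable (a normalized positive operator valued
measure) on the σ-algebra of `Ω`, with values in the bounded operators on the Hilbert space `H`:
every `A X` is a positive operator, `A Ω` is the identity, and `A` is weakly σ-additive.

Only the values of `A` on measurable sets carry information. As for Mathlib's vector measures, a map
defined on the σ-algebra is represented by the function on all subsets that vanishes off the
σ-algebra, so that equality of observables is equality of functions. -/
structure IsObservable {Ω : Type u} [MeasurableSpace Ω] {H : Type v} [NormedAddCommGroup H]
    [InnerProductSpace ℂ H] [CompleteSpace H] (A : Set Ω → H →L[ℂ] H) : Prop where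
  /-- Representation convention: the value off the σ-algebra is `0`. -/
  not_measurable : ∀ X : Set Ω, ¬ MeasurableSet X → A X = 0
  /-- Positivity. -/
  isPositive : ∀ X : Set Ω, MeasurableSet X → (A X).IsPositive
  /-- Normalization. -/
  univ : A Set.univ = 1
  /-- Weak σ-additivity. -/
  hasSum_iUnion : ∀ X : ℕ → Set Ω, (∀ i, MeasurableSet (X i)) →
    (∀ i j, i ≠ j → Disjoint (X i) (X j)) → ∀ φ ψ : H,
      HasSum (fun i => inner ℂ φ (A (X i) ψ)) (inner ℂ φ (A (⋃ i, X i) ψ))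

/-- The set of all observables on the σ-algebra of `Ω` with values in the bounded operators on `H`,
inside the real vector space of all operator valued set functions. -/
def observables (Ω : Type u) [MeasurableSpace Ω] (H : Type v) [NormedAddCommGroup H]
    [InnerProductSpace ℂ H] [CompleteSpace H] : Set (Set Ω → H →L[ℂ] H) :=
  {A | IsObservable A}

/-- The observable `A` is extreme: it is an extreme point of the convex set of observables. -/
def IsExtreme {Ω : Type u} [MeasurableSpace Ω] {H : Type v} [NormedAddCommGroup H]
    [InnerProductSpace ℂ H] [CompleteSpace H] (A : Set Ω → H →L[ℂ] H) : Prop :=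
  A ∈ Set.extremePoints ℝ (observables Ω H)

/-- Absolute continuity of an operator valued set function with respect to a measure. -/
def AbsCont {Ω : Type u} [MeasurableSpace Ω] {H : Type v} [NormedAddCommGroup H]
    [InnerProductSpace ℂ H] (A : Set Ω → H →L[ℂ] H) (μ : Measure Ω) : Prop :=
  ∀ X : Set Ω, MeasurableSet X → μ X = 0 → A X = 0

/-- `A` is discrete: it is absolutely continuous with respect to a sum of Dirac measures at the
points of some finite or countably infinite set `Ξ`. -/
def IsDiscrete {Ω : Type u} [MeasurableSpace Ω] {H : Type v} [NormedAddCommGroup H]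
    [InnerProductSpace ℂ H] (A : Set Ω → H →L[ℂ] H) : Prop :=
  ∃ Ξ : Set Ω, Ξ.Countable ∧ AbsCont A (Measure.sum fun x : Ξ => Measure.dirac (x : Ω))

/-- The range of an operator valued set function on the σ-algebra of `Ω`. -/
def ran {Ω : Type u} [MeasurableSpace Ω] {H : Type v} [NormedAddCommGroup H]
    [InnerProductSpace ℂ H] (A : Set Ω → H →L[ℂ] H) : Set (H →L[ℂ] H) :=
  {T | ∃ X : Set Ω, MeasurableSet X ∧ A X = T}

/-- `A` and `B` are jointly measurable: there is an observable on the product σ-algebra whose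
marginals are `A` and `B`. -/
def JointlyMeasurable {Ω : Type u} [MeasurableSpace Ω] {Ω' : Type w} [MeasurableSpace Ω']
    {H : Type v} [NormedAddCommGroup H] [InnerProductSpace ℂ H] [CompleteSpace H]
    (A : Set Ω → H →L[ℂ] H) (B : Set Ω' → H →L[ℂ] H) : Prop :=
  ∃ N : Set (Ω × Ω') → H →L[ℂ] H, IsObservable N ∧
    (∀ X : Set Ω, MeasurableSet X → N (X ×ˢ Set.univ) = A X) ∧
    (∀ Y : Set Ω', MeasurableSet Y → N (Set.univ ×ˢ Y) = B Y)

/-- `A` and `B` are coexistent: there is an observable `M`, on some σ-algebra over some set `Θ`,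
whose range contains the ranges of `A` and `B`. The universe `x` of `Θ` is a parameter. -/
def Coexistent {Ω : Type u} [MeasurableSpace Ω] {Ω' : Type w} [MeasurableSpace Ω']
    {H : Type v} [NormedAddCommGroup H] [InnerProductSpace ℂ H] [CompleteSpace H]
    (A : Set Ω → H →L[ℂ] H) (B : Set Ω' → H →L[ℂ] H) : Prop :=
  ∃ (Θ : Type x) (_ : MeasurableSpace Θ) (M : Set Θ → H →L[ℂ] H),
    IsObservable M ∧ ran A ∪ ran B ⊆ ran M

end QuantumObservable

/-! Let `M` be an observable whose range contains those of `A` and `B`. Suppose first that `A` lives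
on a countable space with measurable singletons, and write `A {i} = M (Z i)`. By extremality
`M (Z i ∩ Z j) = 0` for `i ≠ j`, since moving this operator from the point `i` to the point `j`, or
back, turns `A` into another observable. Hence `A` is the image of `M` under a map `f`.

Write `B Y = M (W Y)`. The sets `W Y` need not depend additively on `Y`, but the defect of
additivity of `Y ↦ M (f ⁻¹' X ∩ W Y)`, as a function of `X`, again perturbs `A` in both directions,
so it vanishes. As this set function of `Y` is dominated by `B`, it is even σ-additive, and gluing
over the points `i` gives the joint observable `N ({i} × Y) = M (f ⁻¹' {i} ∩ W Y)`.

A general discrete observable is the image of one on a countable space with measurable singletons: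
keep one of the countably many points in each measurable atom. -/

namespace QuantumObservable

open Filter Topology
open scoped ENNReal

section Measure

variable {α : Type*} [MeasurableSpace α]

lemma exists_measure_eq_of_additive_of_le (μ : Measure α) [IsFiniteMeasure μ] {m : Set α → ℝ≥0∞}
    (hadd : ∀ s t, MeasurableSet s → MeasurableSet t → Disjoint s t → m (s ∪ t) = m s + m t)
    (hle : ∀ s, MeasurableSet s → m s ≤ μ s) :
    ∃ ν : Measure α, ∀ s, MeasurableSet s → ν s = m s := by
  have hring : IsSetRing {s : Set α | MeasurableSet s} :=
    ⟨.empty, fun _ _ => .union, fun _ _ => .diff⟩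
  have hempty : m ∅ = 0 := by simpa using hle ∅ .empty
  let content := hring.addContent_of_union m hempty fun {s t} hs ht => hadd s t hs ht
  have hcontinuous (s : ℕ → Set α) (hs : ∀ n, MeasurableSet (s n)) (hanti : Antitone s)
      (hinter : ⋂ n, s n = ∅) : Tendsto (fun n => m (s n)) atTop (𝓝 0) := by
    have hμ : Tendsto (μ ∘ s) atTop (𝓝 0) := by
      simpa [hinter] using tendsto_measure_iInter_atTop (fun n => (hs n).nullMeasurableSet) hanti
        ⟨0, measure_ne_top μ _⟩
    exact tendsto_of_tendsto_of_tendsto_of_le_of_le tendsto_const_nhds hμ (fun _ => zero_le)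
      fun n => hle _ (hs n)
  refine ⟨Measure.ofMeasurable (fun s _ => m s) hempty fun s hs hd => ?_,
    fun s hs => Measure.ofMeasurable_apply s hs⟩
  exact addContent_iUnion_eq_sum_of_tendsto_zero hring content
    (fun s hs => ((hle s hs).trans_lt (measure_lt_top μ s)).ne) hcontinuous hs (.iUnion hs) hd

lemma measure_le_of_forall_singleton_le [Countable α] [MeasurableSingletonClass α]
    {μ ν : Measure α} (h : ∀ a, μ {a} ≤ ν {a}) : μ ≤ ν := by
  refine Measure.le_iff.2 fun s hs => ?_
  rw [← μ.tsum_indicator_apply_singleton s hs, ← ν.tsum_indicator_apply_singleton s hs]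
  exact ENNReal.tsum_le_tsum fun a => Set.indicator_le_indicator (h a)

lemma exists_subset_measurableSingletonClass {Ξ : Set α} (hΞ : Ξ.Countable) :
    ∃ Ξ₀ ⊆ Ξ, MeasurableSingletonClass Ξ₀ ∧
      ∀ Y, MeasurableSet Y → Disjoint Ξ₀ Y → Disjoint Ξ Y := by
  obtain ⟨Ξ₀, hsub, hbij⟩ := Set.exists_subset_bijOn Ξ measurableAtom
  have : Countable Ξ₀ := (hΞ.mono hsub).to_subtype
  have : MeasurableSpace.SeparatesPoints Ξ₀ := ⟨fun a b hab => by
    have hiff (Y : Set α) (hY : MeasurableSet Y) : (a : α) ∈ Y ↔ (b : α) ∈ Y :=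
      ⟨hab _ (measurable_subtype_coe hY), fun hb => not_not.1 fun ha =>
        hab _ (measurable_subtype_coe hY.compl) ha hb⟩
    refine Subtype.ext (hbij.injOn a.2 b.2 (Set.ext fun z => ?_))
    simp only [measurableAtom, Set.mem_iInter]
    grind⟩
  refine ⟨Ξ₀, hsub, inferInstance, fun Y hY hd => Set.disjoint_left.2 fun b hb hbY => ?_⟩
  obtain ⟨a, ha, hab⟩ := hbij.surjOn ⟨b, hb, rfl⟩
  have haY : a ∈ Y := measurableAtom_subset hY hbY (hab ▸ mem_measurableAtom_self a)
  exact Set.disjoint_left.1 hd ha haY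

end Measure

section QuadraticForm

variable {H : Type*} [NormedAddCommGroup H] [InnerProductSpace ℂ H] {S T : H →L[ℂ] H}

/-- The quadratic form `⟪φ, T φ⟫` of a positive operator `T`, with values in `ℝ≥0∞` so that it can
serve as a measure. For operators that are not positive, `ENNReal.ofReal` truncates it at `0`. -/
noncomputable def quadForm (T : H →L[ℂ] H) (φ : H) : ℝ≥0∞ :=
  ENNReal.ofReal (T.reApplyInnerSelf φ)

lemma quadForm_ne_top (T : H →L[ℂ] H) (φ : H) : quadForm T φ ≠ ∞ := ENNReal.ofReal_ne_top

lemma quadForm_zero (φ : H) : quadForm (0 : H →L[ℂ] H) φ = 0 := by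
  simp [quadForm, ContinuousLinearMap.reApplyInnerSelf_apply]

lemma quadForm_add (hS : S.IsPositive) (hT : T.IsPositive) (φ : H) :
    quadForm (S + T) φ = quadForm S φ + quadForm T φ := by
  rw [quadForm, quadForm, quadForm, ← ENNReal.ofReal_add (hS.2 φ) (hT.2 φ)]
  simp [ContinuousLinearMap.reApplyInnerSelf_apply, inner_add_left]

lemma quadForm_mono (h : S ≤ T) (φ : H) : quadForm S φ ≤ quadForm T φ := by
  have hdiff := (ContinuousLinearMap.le_def S T).1 h |>.2 φ
  refine ENNReal.ofReal_le_ofReal (sub_nonneg.1 ?_)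
  simpa [ContinuousLinearMap.reApplyInnerSelf_apply, inner_sub_left] using hdiff

lemma inner_map_self_eq_quadForm (hT : T.IsPositive) (φ : H) :
    inner ℂ (T φ) φ = ((quadForm T φ).toReal : ℂ) := by
  rw [quadForm, ENNReal.toReal_ofReal (hT.2 φ)]
  exact (hT.isSymmetric.coe_reApplyInnerSelf_apply φ).symm

lemma eq_of_forall_quadForm_eq (hS : S.IsPositive) (hT : T.IsPositive)
    (h : ∀ φ, quadForm S φ = quadForm T φ) : S = T := by
  refine ContinuousLinearMap.coe_injective ((ext_inner_map _ _).1 fun φ => ?_)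
  exact (inner_map_self_eq_quadForm hS φ).trans (h φ ▸ (inner_map_self_eq_quadForm hT φ).symm)

lemma hasSum_inner_of_forall_tsum_quadForm_eq {ι : Type*} {T : ι → H →L[ℂ] H}
    (hT : ∀ i, (T i).IsPositive) (hS : S.IsPositive)
    (h : ∀ φ, ∑' i, quadForm (T i) φ = quadForm S φ) (φ ψ : H) :
    HasSum (fun i => inner ℂ φ (T i ψ)) (inner ℂ φ (S ψ)) := by
  have hself (φ : H) : HasSum (fun i => inner ℂ (T i φ) φ) (inner ℂ (S φ) φ) := by
    simp only [inner_map_self_eq_quadForm hS, inner_map_self_eq_quadForm (hT _)]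
    rw [Complex.hasSum_ofReal, ← h φ, ENNReal.tsum_toReal_eq fun i => quadForm_ne_top _ _]
    exact ENNReal.hasSum_toReal (by rw [h φ]; exact quadForm_ne_top _ _)
  have hpolar (R : H →L[ℂ] H) := inner_map_polarization' (R : H →ₗ[ℂ] H) φ ψ
  simp only [ContinuousLinearMap.coe_coe] at hpolar
  simp only [← hS.inner_left_eq_inner_right, ← (hT _).inner_left_eq_inner_right, hpolar]
  exact ((((hself _).sub (hself _)).sub ((hself _).mul_left _)).add
    ((hself _).mul_left _)).div_const _

end QuadraticForm

section Observable

variable {Ω Θ : Type*} [MeasurableSpace Ω] {H : Type*} [NormedAddCommGroup H]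
  [InnerProductSpace ℂ H]

/-- The image of `M` under `g`: the observable `Y ↦ M (g ⁻¹' Y)`, with the value `0` off the
σ-algebra that `IsObservable` requires. -/
noncomputable def map (g : Θ → Ω) (M : Set Θ → H →L[ℂ] H) : Set Ω → H →L[ℂ] H :=
  {Y | MeasurableSet Y}.indicator fun Y => M (g ⁻¹' Y)

lemma map_apply (g : Θ → Ω) (M : Set Θ → H →L[ℂ] H) {Y : Set Ω} (hY : MeasurableSet Y) :
    map g M Y = M (g ⁻¹' Y) :=
  Set.indicator_of_mem (s := {Y | MeasurableSet Y}) hY _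

/-- Weak σ-additivity of an operator valued set function on the measurable sets. Perturbations of
observables satisfy it without being positive or normalized. -/
def IsWeaklySigmaAdditive (D : Set Ω → H →L[ℂ] H) : Prop :=
  ∀ X : ℕ → Set Ω, (∀ i, MeasurableSet (X i)) → Pairwise (Function.onFun Disjoint X) →
    ∀ φ ψ : H, HasSum (fun i => inner ℂ φ (D (X i) ψ)) (inner ℂ φ (D (⋃ i, X i) ψ))

namespace IsWeaklySigmaAdditive

variable {D D' : Set Ω → H →L[ℂ] H}

lemma add (hD : IsWeaklySigmaAdditive D) (hD' : IsWeaklySigmaAdditive D') :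
    IsWeaklySigmaAdditive (D + D') := fun X hX hd φ ψ => by
  simpa [inner_add_right] using (hD X hX hd φ ψ).add (hD' X hX hd φ ψ)

lemma const_smul (hD : IsWeaklySigmaAdditive D) (c : ℝ) :
    IsWeaklySigmaAdditive (c • D) := fun X hX hd φ ψ => by
  simpa [inner_smul_right_eq_smul] using (hD X hX hd φ ψ).const_smul c

lemma neg (hD : IsWeaklySigmaAdditive D) : IsWeaklySigmaAdditive (-D) := fun X hX hd φ ψ => by
  simpa using (hD X hX hd φ ψ).neg

lemma sub (hD : IsWeaklySigmaAdditive D) (hD' : IsWeaklySigmaAdditive D') :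
    IsWeaklySigmaAdditive (D - D') := sub_eq_add_neg D D' ▸ hD.add hD'.neg

lemma preimage_inter [MeasurableSpace Θ] {D : Set Θ → H →L[ℂ] H}
    (hD : IsWeaklySigmaAdditive D) {g : Θ → Ω} (hg : Measurable g) {W : Set Θ}
    (hW : MeasurableSet W) :
    IsWeaklySigmaAdditive fun Y => D (g ⁻¹' Y ∩ W) := fun Y hY hd φ ψ => by
  simp only [Set.preimage_iUnion, Set.iUnion_inter]
  exact hD _ (fun i => (hg (hY i)).inter hW)
    (fun i j hij => ((hd hij).preimage g).mono Set.inter_subset_left Set.inter_subset_left) φ ψ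

end IsWeaklySigmaAdditive

lemma isWeaklySigmaAdditive_dirac (x : Ω) (E : H →L[ℂ] H) :
    IsWeaklySigmaAdditive fun Y => Y.indicator (fun _ => E) x := fun X hX hd φ ψ => by
  classical
  have hdirac {Y : Set Ω} (hY : MeasurableSet Y) :
      VectorMeasure.dirac x (inner ℂ φ (E ψ)) Y =
        inner ℂ φ (Y.indicator (fun _ => E) x ψ) := by
    by_cases hx : x ∈ Y
    · rw [VectorMeasure.dirac_apply_of_mem hY hx, Set.indicator_of_mem hx]
    · rw [VectorMeasure.dirac_apply_of_notMem hx, Set.indicator_of_notMem hx]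
      simp
  simpa only [hdirac (hX _), hdirac (.iUnion hX)] using
    (VectorMeasure.dirac x (inner ℂ φ (E ψ))).m_iUnion hX hd

lemma isWeaklySigmaAdditive_of_forall_exists_measure {A : Set Ω → H →L[ℂ] H}
    (hpos : ∀ X, MeasurableSet X → (A X).IsPositive)
    (h : ∀ φ, ∃ μ : Measure Ω, ∀ X, MeasurableSet X → μ X = quadForm (A X) φ) :
    IsWeaklySigmaAdditive A := fun X hX hd =>
  hasSum_inner_of_forall_tsum_quadForm_eq (fun i => hpos _ (hX i)) (hpos _ (.iUnion hX)) fun φ => by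
    obtain ⟨μ, hμ⟩ := h φ
    simp only [← hμ _ (hX _), ← hμ _ (.iUnion hX), measure_iUnion hd hX]

variable [MeasurableSpace Θ] [CompleteSpace H] {A : Set Ω → H →L[ℂ] H} {M : Set Θ → H →L[ℂ] H}

lemma isObservable_indicator (hpos : ∀ X, MeasurableSet X → (A X).IsPositive)
    (huniv : A Set.univ = 1) (hsum : IsWeaklySigmaAdditive A) :
    IsObservable ({X | MeasurableSet X}.indicator A) where
  not_measurable X hX := Set.indicator_of_notMem (s := {X | MeasurableSet X}) hX A
  isPositive X hX := by simpa [hX] using hpos X hX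
  univ := by simpa using huniv
  hasSum_iUnion X hX hd := by
    simpa [hX, MeasurableSet.iUnion hX] using hsum X hX fun i j => hd i j

namespace IsObservable

lemma isWeaklySigmaAdditive (hA : IsObservable A) : IsWeaklySigmaAdditive A :=
  fun X hX hd => hA.hasSum_iUnion X hX fun _ _ hij => hd hij

lemma map (hM : IsObservable M) {g : Θ → Ω} (hg : Measurable g) : IsObservable (map g M) :=
  isObservable_indicator (fun _ hY => hM.isPositive _ (hg hY)) hM.univ <| by
    simpa using hM.isWeaklySigmaAdditive.preimage_inter hg .univ

lemma nonneg (hA : IsObservable A) {X : Set Ω} (hX : MeasurableSet X) : 0 ≤ A X :=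
  (ContinuousLinearMap.nonneg_iff_isPositive _).2 (hA.isPositive X hX)

lemma empty (hA : IsObservable A) : A ∅ = 0 := by
  have hzero (φ ψ : H) : inner ℂ φ (A ∅ ψ) = 0 := by
    have hconst := hA.hasSum_iUnion (fun _ => ∅) (fun _ => .empty) (by simp) φ ψ
    exact (summable_const_iff _).1 hconst.summable
  exact ContinuousLinearMap.ext fun ψ => ext_inner_left ℂ fun φ => by simpa using hzero φ ψ

/-- The scalar measure `X ↦ ⟪φ, A X φ⟫` of an observable `A`. -/
noncomputable def toMeasure (hA : IsObservable A) (φ : H) : Measure Ω :=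
  Measure.ofMeasurable (fun X _ => quadForm (A X) φ) (by rw [hA.empty, quadForm_zero])
    fun X hX hd => by
      have hsum := hA.hasSum_iUnion X hX (fun i j hij => hd hij) φ φ
      simp only [← (hA.isPositive _ (hX _)).inner_left_eq_inner_right,
        ← (hA.isPositive _ (.iUnion hX)).inner_left_eq_inner_right,
        inner_map_self_eq_quadForm (hA.isPositive _ (hX _)),
        inner_map_self_eq_quadForm (hA.isPositive _ (.iUnion hX)), Complex.hasSum_ofReal] at hsum
      rw [← ENNReal.ofReal_toReal (quadForm_ne_top (A (⋃ i, X i)) φ), ← hsum.tsum_eq,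
        ENNReal.ofReal_tsum_of_nonneg (fun _ => ENNReal.toReal_nonneg) hsum.summable]
      exact tsum_congr fun i => ENNReal.ofReal_toReal (quadForm_ne_top _ _)

lemma toMeasure_apply (hA : IsObservable A) (φ : H) {X : Set Ω} (hX : MeasurableSet X) :
    hA.toMeasure φ X = quadForm (A X) φ :=
  Measure.ofMeasurable_apply X hX

instance isFiniteMeasure_toMeasure (hA : IsObservable A) (φ : H) :
    IsFiniteMeasure (hA.toMeasure φ) :=
  ⟨by rw [hA.toMeasure_apply φ .univ]; exact (quadForm_ne_top _ _).lt_top⟩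

lemma union (hA : IsObservable A) {X Y : Set Ω} (hX : MeasurableSet X) (hY : MeasurableSet Y)
    (hd : Disjoint X Y) : A (X ∪ Y) = A X + A Y := by
  have hX' := hA.isPositive X hX
  have hY' := hA.isPositive Y hY
  refine eq_of_forall_quadForm_eq (hA.isPositive _ (hX.union hY)) (hX'.add hY') fun φ => ?_
  simp only [quadForm_add hX' hY', ← hA.toMeasure_apply φ hX, ← hA.toMeasure_apply φ hY,
    ← hA.toMeasure_apply φ (hX.union hY), measure_union hd hY]

lemma inter_add_sdiff (hA : IsObservable A) {X Y : Set Ω} (hX : MeasurableSet X)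
    (hY : MeasurableSet Y) : A (X ∩ Y) + A (X \ Y) = A X := by
  rw [← hA.union (hX.inter hY) (hX.diff hY)
    (Set.disjoint_sdiff_right.mono_left Set.inter_subset_right), Set.inter_union_sdiff]

lemma mono (hA : IsObservable A) {X Y : Set Ω} (hX : MeasurableSet X) (hY : MeasurableSet Y)
    (h : X ⊆ Y) : A X ≤ A Y := by
  rw [← hA.inter_add_sdiff hY hX, Set.inter_eq_right.2 h]
  exact le_add_of_nonneg_right (hA.nonneg (hY.diff hX))

lemma inter_eq_of_eq_one (hA : IsObservable A) {X Y : Set Ω} (hX : MeasurableSet X)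
    (hY : MeasurableSet Y) (h : A Y = 1) : A (X ∩ Y) = A X := by
  have hcompl : A Yᶜ = 0 := by
    simpa [hA.univ, h, ← Set.compl_eq_univ_sdiff] using hA.inter_add_sdiff .univ hY
  have hsdiff : A (X \ Y) = 0 :=
    le_antisymm (hcompl ▸ hA.mono (hX.diff hY) hY.compl fun _ hx => hx.2) (hA.nonneg (hX.diff hY))
  rw [← hA.inter_add_sdiff hX hY, hsdiff, add_zero]

lemma sdiff_iUnion_eq_of_inter_eq_zero {ι : Type*} [Countable ι] (hA : IsObservable A) {X : Set Ω}
    {Y : ι → Set Ω} (hX : MeasurableSet X) (hY : ∀ i, MeasurableSet (Y i))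
    (h : ∀ i, A (X ∩ Y i) = 0) : A (X \ ⋃ i, Y i) = A X := by
  have hdiff : MeasurableSet (X \ ⋃ i, Y i) := hX.diff (.iUnion hY)
  refine eq_of_forall_quadForm_eq (hA.isPositive _ hdiff) (hA.isPositive X hX) fun φ => ?_
  rw [← hA.toMeasure_apply φ hdiff, ← hA.toMeasure_apply φ hX]
  refine measure_sdiff_null' ?_
  rw [Set.inter_iUnion, measure_iUnion_null_iff]
  intro i
  rw [hA.toMeasure_apply φ (hX.inter (hY i)), h i, quadForm_zero]

lemma eq_of_forall_singleton_le [Countable Ω] [MeasurableSingletonClass Ω]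
    {A' : Set Ω → H →L[ℂ] H} (hA : IsObservable A) (hA' : IsObservable A')
    (h : ∀ x, A {x} ≤ A' {x}) : A = A' := by
  have hmeasure (φ : H) : hA.toMeasure φ = hA'.toMeasure φ := by
    refine Measure.eq_of_le_of_measure_univ_eq (measure_le_of_forall_singleton_le fun x => ?_) ?_
    · simpa only [toMeasure_apply _ φ (measurableSet_singleton x)] using quadForm_mono (h x) φ
    · rw [hA.toMeasure_apply φ .univ, hA'.toMeasure_apply φ .univ, hA.univ, hA'.univ]
  funext X
  have hX : MeasurableSet X := X.to_countable.measurableSet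
  refine eq_of_forall_quadForm_eq (hA.isPositive X hX) (hA'.isPositive X hX) fun φ => ?_
  rw [← hA.toMeasure_apply φ hX, ← hA'.toMeasure_apply φ hX, hmeasure φ]

lemma nonempty [Nontrivial H] (hA : IsObservable A) : Nonempty Ω := by
  by_contra hΩ
  rw [not_nonempty_iff] at hΩ
  have huniv := hA.univ
  rw [Set.univ_eq_empty_iff.2 hΩ, hA.empty] at huniv
  exact zero_ne_one huniv

end IsObservable

end Observable

section Extreme

variable {Ω Θ : Type*} [MeasurableSpace Ω] [MeasurableSpace Θ] {H : Type*} [NormedAddCommGroup H]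
  [InnerProductSpace ℂ H] [CompleteSpace H] {A : Set Ω → H →L[ℂ] H} {M : Set Θ → H →L[ℂ] H}

namespace IsExtreme

lemma eq_zero_of_le_smul (hA : IsExtreme A) {D : Set Ω → H →L[ℂ] H}
    (hD : IsWeaklySigmaAdditive D) {c : ℝ} (hc : 0 < c)
    (hle : ∀ X, MeasurableSet X → D X ≤ c • A X) (hge : ∀ X, MeasurableSet X → -D X ≤ c • A X)
    (huniv : D Set.univ = 0) {X : Set Ω} (hX : MeasurableSet X) : D X = 0 := by
  have hperturb {D' : Set Ω → H →L[ℂ] H} (hD' : IsWeaklySigmaAdditive D')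
      (hle' : ∀ X, MeasurableSet X → D' X ≤ c • A X) (huniv' : D' Set.univ = 0) :
      IsObservable ({X | MeasurableSet X}.indicator (A - c⁻¹ • D')) := by
    refine isObservable_indicator (fun X hX => (ContinuousLinearMap.le_def _ _).1 ?_)
      (by simp [huniv', hA.1.univ]) (hA.1.isWeaklySigmaAdditive.sub (hD'.const_smul _))
    simpa [hc.ne'] using smul_le_smul_of_nonneg_left (hle' X hX) (inv_nonneg.2 hc.le)
  have heq := hA.2 (hperturb hD hle huniv) (hperturb hD.neg hge (by simp [huniv]))
    ⟨1 / 2, 1 / 2, by norm_num, by norm_num, by norm_num, funext fun Y => by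
      by_cases hY : MeasurableSet Y
      · simp only [Pi.add_apply, Pi.smul_apply, Pi.sub_apply, Pi.neg_apply, Set.mem_ofPred_eq, hY,
          Set.indicator_of_mem]
        module
      · simp [hY, hA.1.not_measurable Y hY]⟩
  simpa [hX, hc.ne'] using congrFun heq X

lemma eq_zero_of_le_singleton [MeasurableSingletonClass Ω] (hA : IsExtreme A) {i j : Ω}
    (hij : i ≠ j) {E : H →L[ℂ] H} (hE : 0 ≤ E) (hi : E ≤ A {i}) (hj : E ≤ A {j}) : E = 0 := by
  have hnonneg (k : Ω) (Y : Set Ω) : 0 ≤ Y.indicator (fun _ => E) k :=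
    Set.indicator_nonneg (fun _ _ => hE) k
  have hle {k : Ω} (hk : E ≤ A {k}) {Y : Set Ω} (hY : MeasurableSet Y) :
      Y.indicator (fun _ => E) k ≤ A Y :=
    Set.indicator_apply_le' (fun hkY => hk.trans <| hA.1.mono (measurableSet_singleton k) hY <|
      Set.singleton_subset_iff.2 hkY) fun _ => hA.1.nonneg hY
  have hzero := hA.eq_zero_of_le_smul
    ((isWeaklySigmaAdditive_dirac i E).sub (isWeaklySigmaAdditive_dirac j E)) one_pos
    (fun Y hY => by simpa using (sub_le_self _ (hnonneg j Y)).trans (hle hi hY))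
    (fun Y hY => by simpa using (sub_le_self _ (hnonneg i Y)).trans (hle hj hY))
    (by simp) (measurableSet_singleton i)
  simpa [hij.symm] using hzero

lemma apply_preimage_inter_eq_add {g : Θ → Ω} (hA : IsExtreme (map g M)) (hM : IsObservable M)
    (hg : Measurable g) {W W₁ W₂ : Set Θ} (hW : MeasurableSet W) (hW₁ : MeasurableSet W₁)
    (hW₂ : MeasurableSet W₂) (hadd : M W = M W₁ + M W₂) {X : Set Ω} (hX : MeasurableSet X) :
    M (g ⁻¹' X ∩ W) = M (g ⁻¹' X ∩ W₁) + M (g ⁻¹' X ∩ W₂) := by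
  have hσ {V : Set Θ} (hV : MeasurableSet V) := hM.isWeaklySigmaAdditive.preimage_inter hg hV
  have hnonneg {V : Set Θ} (hV : MeasurableSet V) {X : Set Ω} (hX : MeasurableSet X) :
      0 ≤ M (g ⁻¹' X ∩ V) := hM.nonneg ((hg hX).inter hV)
  have hle {V : Set Θ} (hV : MeasurableSet V) {X : Set Ω} (hX : MeasurableSet X) :
      M (g ⁻¹' X ∩ V) ≤ map g M X :=
    map_apply g M hX ▸ hM.mono ((hg hX).inter hV) (hg hX) Set.inter_subset_left
  have hdefect := hA.eq_zero_of_le_smul (((hσ hW₁).add (hσ hW₂)).sub (hσ hW)) two_pos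
    (fun X hX => ?_) (fun X hX => ?_) (by simp [hadd]) hX
  · exact (sub_eq_zero.1 hdefect).symm
  · rw [two_smul]
    exact (sub_le_self _ (hnonneg hW hX)).trans (add_le_add (hle hW₁ hX) (hle hW₂ hX))
  · simp only [Pi.sub_apply, Pi.add_apply, neg_sub, two_smul]
    exact (sub_le_self _ (add_nonneg (hnonneg hW₁ hX) (hnonneg hW₂ hX))).trans <|
      (hle hW hX).trans <| le_add_of_nonneg_left (hA.1.nonneg hX)

lemma exists_map_eq [Nontrivial H] [Countable Ω] [MeasurableSingletonClass Ω] (hA : IsExtreme A)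
    (hM : IsObservable M) (h : ∀ i, A {i} ∈ ran M) : ∃ f : Θ → Ω, Measurable f ∧ map f M = A := by
  choose Z hZ hMZ using h
  have hinter {i j : Ω} (hij : i ≠ j) : M (Z i ∩ Z j) = 0 := by
    have hij' := (hZ i).inter (hZ j)
    exact hA.eq_zero_of_le_singleton hij (hM.nonneg hij')
      (hMZ i ▸ hM.mono hij' (hZ i) Set.inter_subset_left)
      (hMZ j ▸ hM.mono hij' (hZ j) Set.inter_subset_right)
  let P (i : Ω) : Set Θ := Z i \ ⋃ j : {j // j ≠ i}, Z j
  have hP (i : Ω) : MeasurableSet (P i) := (hZ i).diff (.iUnion fun j => hZ j)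
  have hMP (i : Ω) : M (P i) = A {i} := (hM.sdiff_iUnion_eq_of_inter_eq_zero (hZ i)
    (fun j : {j // j ≠ i} => hZ j) fun j => hinter j.2.symm).trans (hMZ i)
  have hPd {i j : Ω} (hij : i ≠ j) : Disjoint (P i) (P j) :=
    Set.disjoint_left.2 fun θ hi hj => hj.2 (Set.mem_iUnion.2 ⟨⟨i, hij⟩, hi.1⟩)
  have : Nonempty Ω := hA.1.nonempty
  obtain ⟨f, hf, hfP⟩ := exists_measurable_piecewise P hP (fun i _ => i)
    (fun i => measurable_const) fun i j hij => by simp [(hPd hij).inter_eq]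
  refine ⟨f, hf, .symm <| hA.1.eq_of_forall_singleton_le (hM.map hf) fun i => ?_⟩
  rw [map_apply f M (measurableSet_singleton i), ← hMP i]
  exact hM.mono (hP i) (hf (measurableSet_singleton i)) fun θ hθ => hfP i hθ

end IsExtreme

end Extreme

section Glue

variable {Ω Ω' Θ : Type*} {f : Θ → Ω} {W : Set Ω' → Set Θ}

/-- The set representing `Q ⊆ Ω × Ω'`, given a map `f` into `Ω` and sets `W Y` representing the
sets `Y ⊆ Ω'`: over each point `a`, it is the part of `f ⁻¹' {a}` in the set representing the
section of `Q` at `a`. -/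
def fiberGlue (f : Θ → Ω) (W : Set Ω' → Set Θ) (Q : Set (Ω × Ω')) : Set Θ :=
  {θ | θ ∈ W (Prod.mk (f θ) ⁻¹' Q)}

lemma fiberGlue_eq_iUnion (f : Θ → Ω) (W : Set Ω' → Set Θ) (Q : Set (Ω × Ω')) :
    fiberGlue f W Q = ⋃ a, f ⁻¹' {a} ∩ W (Prod.mk a ⁻¹' Q) := by
  ext θ
  simp [fiberGlue]

lemma fiberGlue_univ_prod (f : Θ → Ω) (W : Set Ω' → Set Θ) (Y : Set Ω') :
    fiberGlue f W (Set.univ ×ˢ Y) = W Y := by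
  ext θ
  simp [fiberGlue, Set.mk_preimage_prod_right]

lemma preimage_inter_subset_fiberGlue (f : Θ → Ω) (W : Set Ω' → Set Θ) (X : Set Ω) :
    f ⁻¹' X ∩ W Set.univ ⊆ fiberGlue f W (X ×ˢ Set.univ) := fun θ hθ => by
  simpa [fiberGlue, Set.mk_preimage_prod_right (Set.mem_preimage.1 hθ.1)] using hθ.2

variable [Countable Ω] [MeasurableSpace Ω] [MeasurableSingletonClass Ω] [MeasurableSpace Ω']
  [MeasurableSpace Θ]

lemma measurableSet_fiberGlue (hf : Measurable f)
    (hW : ∀ Y, MeasurableSet Y → MeasurableSet (W Y)) {Q : Set (Ω × Ω')} (hQ : MeasurableSet Q) :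
    MeasurableSet (fiberGlue f W Q) :=
  fiberGlue_eq_iUnion f W Q ▸ .iUnion fun a =>
    (hf (measurableSet_singleton a)).inter (hW _ (measurable_prodMk_left hQ))

lemma measure_fiberGlue (μ : Measure Θ) (hf : Measurable f)
    (hW : ∀ Y, MeasurableSet Y → MeasurableSet (W Y)) {Q : Set (Ω × Ω')} (hQ : MeasurableSet Q) :
    μ (fiberGlue f W Q) = ∑' a, μ (f ⁻¹' {a} ∩ W (Prod.mk a ⁻¹' Q)) := by
  rw [fiberGlue_eq_iUnion]
  exact measure_iUnion
    (fun a b hab => ((Set.disjoint_singleton.2 hab).preimage f).mono Set.inter_subset_left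
      Set.inter_subset_left)
    fun a => (hf (measurableSet_singleton a)).inter (hW _ (measurable_prodMk_left hQ))

end Glue

section Joint

variable {Ω Ω' Θ : Type*} [MeasurableSpace Ω] [MeasurableSpace Ω'] [MeasurableSpace Θ] {H : Type*}
  [NormedAddCommGroup H] [InnerProductSpace ℂ H] [CompleteSpace H] {M : Set Θ → H →L[ℂ] H}
  {B : Set Ω' → H →L[ℂ] H} {f : Θ → Ω} {W : Set Ω' → Set Θ}

namespace IsExtreme

lemma exists_measure_eq_quadForm_preimage_inter (hA : IsExtreme (map f M)) (hM : IsObservable M)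
    (hf : Measurable f) (hB : IsObservable B) (hW : ∀ Y, MeasurableSet Y → MeasurableSet (W Y))
    (hMW : ∀ Y, MeasurableSet Y → M (W Y) = B Y) {X : Set Ω} (hX : MeasurableSet X) (φ : H) :
    ∃ ν : Measure Ω', ∀ Y, MeasurableSet Y → ν Y = quadForm (M (f ⁻¹' X ∩ W Y)) φ := by
  have hXW (Y : Set Ω') (hY : MeasurableSet Y) := (hf hX).inter (hW Y hY)
  refine exists_measure_eq_of_additive_of_le (hB.toMeasure φ) (fun Y Y' hY hY' hd => ?_)
    fun Y hY => ?_
  · have hMadd : M (W (Y ∪ Y')) = M (W Y) + M (W Y') := by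
      rw [hMW _ hY, hMW _ hY', hMW _ (hY.union hY'), hB.union hY hY' hd]
    rw [hA.apply_preimage_inter_eq_add hM hf (hW _ (hY.union hY')) (hW Y hY) (hW Y' hY') hMadd hX,
      quadForm_add (hM.isPositive _ (hXW Y hY)) (hM.isPositive _ (hXW Y' hY'))]
  · rw [hB.toMeasure_apply φ hY, ← hMW Y hY]
    exact quadForm_mono (hM.mono (hXW Y hY) (hW Y hY) Set.inter_subset_right) φ

variable [Countable Ω] [MeasurableSingletonClass Ω]

lemma isObservable_fiberGlue (hA : IsExtreme (map f M)) (hM : IsObservable M) (hf : Measurable f)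
    (hB : IsObservable B) (hW : ∀ Y, MeasurableSet Y → MeasurableSet (W Y))
    (hMW : ∀ Y, MeasurableSet Y → M (W Y) = B Y) :
    IsObservable ({Q | MeasurableSet Q}.indicator fun Q => M (fiberGlue f W Q)) := by
  have hglue {Q : Set (Ω × Ω')} (hQ : MeasurableSet Q) := measurableSet_fiberGlue hf hW hQ
  have hpos (Q : Set (Ω × Ω')) (hQ : MeasurableSet Q) : (M (fiberGlue f W Q)).IsPositive :=
    hM.isPositive _ (hglue hQ)
  refine isObservable_indicator hpos ?_ <| isWeaklySigmaAdditive_of_forall_exists_measure hpos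
    fun φ => ?_
  · rw [← Set.univ_prod_univ, fiberGlue_univ_prod, hMW _ .univ, hB.univ]
  · choose ν hν using fun a => hA.exists_measure_eq_quadForm_preimage_inter hM hf hB hW hMW
      (measurableSet_singleton a) φ
    refine ⟨.sum fun a => (ν a).map (Prod.mk a), fun Q hQ => ?_⟩
    rw [← hM.toMeasure_apply φ (hglue hQ), measure_fiberGlue _ hf hW hQ, Measure.sum_apply _ hQ]
    refine tsum_congr fun a => ?_
    have hQa : MeasurableSet (Prod.mk a ⁻¹' Q) := measurable_prodMk_left hQ
    rw [Measure.map_apply measurable_prodMk_left hQ, hν a _ hQa,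
      hM.toMeasure_apply φ ((hf (measurableSet_singleton a)).inter (hW _ hQa))]

lemma jointlyMeasurable_map (hA : IsExtreme (map f M)) (hM : IsObservable M) (hf : Measurable f)
    (hB : IsObservable B) (hran : ran B ⊆ ran M) : JointlyMeasurable (map f M) B := by
  have hrep (Y : Set Ω') (hY : MeasurableSet Y) : ∃ V, MeasurableSet V ∧ M V = B Y :=
    hran ⟨Y, hY, rfl⟩
  choose! W hW hMW using hrep
  let N := {Q : Set (Ω × Ω') | MeasurableSet Q}.indicator fun Q => M (fiberGlue f W Q)
  have hN : IsObservable N := hA.isObservable_fiberGlue hM hf hB hW hMW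
  have hNapply {Q : Set (Ω × Ω')} (hQ : MeasurableSet Q) : N Q = M (fiberGlue f W Q) :=
    Set.indicator_of_mem (s := {Q | MeasurableSet Q}) hQ _
  have hfst : map f M = map Prod.fst N := by
    refine hA.1.eq_of_forall_singleton_le (hN.map measurable_fst) fun a => ?_
    have ha := measurableSet_singleton a
    have hWuniv : M (W Set.univ) = 1 := (hMW _ .univ).trans hB.univ
    rw [map_apply f M ha, map_apply _ N ha, ← Set.prod_univ, hNapply (ha.prod .univ),
      ← hM.inter_eq_of_eq_one (hf ha) (hW _ .univ) hWuniv]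
    exact hM.mono ((hf ha).inter (hW _ .univ)) (measurableSet_fiberGlue hf hW (ha.prod .univ))
      (preimage_inter_subset_fiberGlue f W {a})
  refine ⟨N, hN, fun X hX => ?_, fun Y hY => ?_⟩
  · rw [hfst, map_apply _ N hX, Set.prod_univ]
  · rw [hNapply (MeasurableSet.univ.prod hY), fiberGlue_univ_prod, hMW Y hY]

end IsExtreme

end Joint

section Trace

variable {Ω Θ : Type*} [MeasurableSpace Ω] [MeasurableSpace Θ] {H : Type*} [NormedAddCommGroup H]
  [InnerProductSpace ℂ H]

lemma ran_subset_ran_map {g : Θ → Ω}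
    (hg : ∀ U, MeasurableSet U → ∃ Y, MeasurableSet Y ∧ g ⁻¹' Y = U)
    (M : Set Θ → H →L[ℂ] H) : ran M ⊆ ran (map g M) := by
  rintro _ ⟨U, hU, rfl⟩
  obtain ⟨Y, hY, rfl⟩ := hg U hU
  exact ⟨Y, hY, map_apply g M hY⟩

lemma AbsCont.eq_zero_of_disjoint {A : Set Ω → H →L[ℂ] H} {Ξ : Set Ω}
    (hA : AbsCont A (Measure.sum fun x : Ξ => Measure.dirac (x : Ω))) {Y : Set Ω}
    (hY : MeasurableSet Y) (hd : Disjoint Ξ Y) : A Y = 0 := by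
  refine hA Y hY ?_
  rw [Measure.sum_apply_eq_zero' hY]
  intro x
  rw [Measure.dirac_apply' _ hY, Set.indicator_of_notMem (Set.disjoint_left.1 hd x.2)]

variable [CompleteSpace H] {A : Set Ω → H →L[ℂ] H} {M : Set Θ → H →L[ℂ] H}

lemma IsExtreme.of_map {g : Θ → Ω} (hM : IsObservable M) (hgm : Measurable g)
    (hg : ∀ U, MeasurableSet U → ∃ Y, MeasurableSet Y ∧ g ⁻¹' Y = U) (h : IsExtreme (map g M)) :
    IsExtreme M := by
  refine ⟨hM, fun M₁ hM₁ M₂ hM₂ ⟨a, b, ha, hb, hab, heq⟩ => ?_⟩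
  have hmap : map g M₁ = map g M := h.2 (hM₁.map hgm) (hM₂.map hgm)
    ⟨a, b, ha, hb, hab, funext fun Y => by
      by_cases hY : MeasurableSet Y
      · simp [map, hY, ← heq]
      · simp [map, hY]⟩
  funext U
  by_cases hU : MeasurableSet U
  · obtain ⟨Y, hY, rfl⟩ := hg U hU
    rw [← map_apply g M₁ hY, hmap, map_apply g M hY]
  · rw [hM₁.not_measurable U hU, hM.not_measurable U hU]

namespace IsObservable

lemma eq_of_preimage_eq {α : Type*} {g : α → Ω} (hA : IsObservable A)
    (hzero : ∀ Y, MeasurableSet Y → g ⁻¹' Y = ∅ → A Y = 0) {Y Y' : Set Ω} (hY : MeasurableSet Y)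
    (hY' : MeasurableSet Y') (h : g ⁻¹' Y = g ⁻¹' Y') : A Y = A Y' := by
  have hsdiff : A (Y \ Y') = 0 := hzero _ (hY.diff hY') (by simp [h])
  have hsdiff' : A (Y' \ Y) = 0 := hzero _ (hY'.diff hY) (by simp [h])
  rw [← hA.inter_add_sdiff hY hY', ← hA.inter_add_sdiff hY' hY, hsdiff, hsdiff', Set.inter_comm]

lemma exists_map_eq {g : Θ → Ω} (hA : IsObservable A) (hgm : Measurable g)
    (hg : ∀ U, MeasurableSet U → ∃ Y, MeasurableSet Y ∧ g ⁻¹' Y = U)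
    (hzero : ∀ Y, MeasurableSet Y → g ⁻¹' Y = ∅ → A Y = 0) :
    ∃ A₀ : Set Θ → H →L[ℂ] H, IsObservable A₀ ∧ QuantumObservable.map g A₀ = A := by
  choose! r hr hgr using hg
  refine ⟨{U | MeasurableSet U}.indicator (A ∘ r),
    isObservable_indicator (fun U hU => hA.isPositive _ (hr U hU)) ?_ fun U hU hd => ?_, ?_⟩
  · rw [Function.comp_apply, hA.eq_of_preimage_eq hzero (hr _ .univ) .univ (hgr _ .univ), hA.univ]
  · refine hasSum_inner_of_forall_tsum_quadForm_eq (fun i => hA.isPositive _ (hr _ (hU i)))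
      (hA.isPositive _ (hr _ (.iUnion hU))) fun φ => ?_
    have hrU (i : ℕ) : MeasurableSet (r (U i)) := hr _ (hU i)
    have hae : Pairwise (Function.onFun (AEDisjoint (hA.toMeasure φ)) fun i => r (U i)) :=
      fun i j hij => by
        rw [Function.onFun, AEDisjoint, hA.toMeasure_apply φ ((hrU i).inter (hrU j)),
          hzero _ ((hrU i).inter (hrU j)) ?_, quadForm_zero]
        rw [Set.preimage_inter, hgr _ (hU i), hgr _ (hU j), (hd hij).inter_eq]
    have hunion : A (r (⋃ i, U i)) = A (⋃ i, r (U i)) := by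
      refine hA.eq_of_preimage_eq hzero (hr _ (.iUnion hU)) (.iUnion hrU) ?_
      simp only [Set.preimage_iUnion, hgr _ (hU _), hgr _ (.iUnion hU)]
    simp only [Function.comp_apply]
    rw [hunion, ← hA.toMeasure_apply φ (.iUnion hrU),
      measure_iUnion₀ hae fun i => (hrU i).nullMeasurableSet]
    exact tsum_congr fun i => (hA.toMeasure_apply φ (hrU i)).symm
  · funext Y
    by_cases hY : MeasurableSet Y
    · rw [map_apply _ _ hY, Set.indicator_of_mem (s := {U | MeasurableSet U}) (hgm hY)]
      exact hA.eq_of_preimage_eq hzero (hr _ (hgm hY)) hY (hgr _ (hgm hY))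
    · rw [hA.not_measurable Y hY, QuantumObservable.map,
        Set.indicator_of_notMem (s := {Y | MeasurableSet Y}) hY]

end IsObservable

lemma IsExtreme.exists_map_subtype_val_eq (hA : IsExtreme A) (hdiscrete : IsDiscrete A) :
    ∃ Ξ : Set Ω, Countable Ξ ∧ MeasurableSingletonClass Ξ ∧
      ∃ A₀ : Set Ξ → H →L[ℂ] H, IsExtreme A₀ ∧ map Subtype.val A₀ = A := by
  obtain ⟨Ξ, hΞ, hac⟩ := hdiscrete
  obtain ⟨Ξ₀, hsub, hsingleton, hdisjoint⟩ := exists_subset_measurableSingletonClass hΞ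
  obtain ⟨A₀, hA₀, rfl⟩ := hA.1.exists_map_eq (g := ((↑) : Ξ₀ → Ω)) measurable_subtype_coe
    (fun _ hU => hU) fun Y hY hpre => hac.eq_zero_of_disjoint hY <| hdisjoint Y hY <|
      Set.disjoint_iff_inter_eq_empty.2 (Subtype.preimage_coe_eq_empty.1 hpre)
  exact ⟨Ξ₀, (hΞ.mono hsub).to_subtype, hsingleton, A₀,
    .of_map hA₀ measurable_subtype_coe (fun _ hU => hU) hA, rfl⟩

end Trace

section Coexistence

variable {Ω : Type u} {Ω' : Type w} [MeasurableSpace Ω] [MeasurableSpace Ω'] {H : Type v}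
  [NormedAddCommGroup H] [InnerProductSpace ℂ H] [CompleteSpace H] {A : Set Ω → H →L[ℂ] H}
  {B : Set Ω' → H →L[ℂ] H}

lemma JointlyMeasurable.map_left {Θ : Type*} [MeasurableSpace Θ] {g : Ω → Θ} (hg : Measurable g)
    (h : JointlyMeasurable A B) : JointlyMeasurable (map g A) B := by
  obtain ⟨N, hN, hfst, hsnd⟩ := h
  have hmap : Measurable (Prod.map g (id : Ω' → Ω')) := hg.prodMap measurable_id
  refine ⟨map (Prod.map g id) N, hN.map hmap, fun X hX => ?_, fun Y hY => ?_⟩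
  · rw [map_apply _ N (hX.prod .univ), map_apply g A hX, ← hfst _ (hg hX),
      Set.preimage_prod_map_prod, Set.preimage_univ]
  · rw [map_apply _ N (MeasurableSet.univ.prod hY), Set.preimage_prod_map_prod, Set.preimage_univ,
      Set.preimage_id, hsnd Y hY]

lemma JointlyMeasurable.coexistent (h : JointlyMeasurable A B) :
    Coexistent.{u, v, w, max u w x} A B := by
  obtain ⟨N, hN, hfst, hsnd⟩ := h
  have hran : ran N ⊆ ran (map ULift.up.{x} N) :=
    ran_subset_ran_map (fun Q hQ => ⟨ULift.down ⁻¹' Q, measurable_down hQ, rfl⟩) N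
  refine ⟨ULift.{x} (Ω × Ω'), inferInstance, map ULift.up N, hN.map measurable_up,
    Set.Subset.trans (Set.union_subset ?_ ?_) hran⟩
  · rintro _ ⟨X, hX, rfl⟩
    exact ⟨_, hX.prod .univ, hfst X hX⟩
  · rintro _ ⟨Y, hY, rfl⟩
    exact ⟨_, MeasurableSet.univ.prod hY, hsnd Y hY⟩

lemma Coexistent.jointlyMeasurable [Nontrivial H] (h : Coexistent.{u, v, w, x} A B)
    (hdiscrete : IsDiscrete A) (hA : IsExtreme A) (hB : IsObservable B) :
    JointlyMeasurable A B := by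
  obtain ⟨Ξ, _, _, A₀, hA₀, rfl⟩ := hA.exists_map_subtype_val_eq hdiscrete
  obtain ⟨Θ, _, M, hM, hran⟩ := h
  rw [Set.union_subset_iff] at hran
  have hranA₀ : ran A₀ ⊆ ran M :=
    (ran_subset_ran_map (g := ((↑) : Ξ → Ω)) (fun _ hU => hU) A₀).trans hran.1
  obtain ⟨f, hf, rfl⟩ := hA₀.exists_map_eq hM fun i => hranA₀ ⟨{i}, measurableSet_singleton i, rfl⟩
  exact (hA₀.jointlyMeasurable_map hM hf hB hran.2).map_left measurable_subtype_coe

end Coexistence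

end QuantumObservable

theorem corollary5p2p2014_general {Ω : Type u} [MeasurableSpace Ω]
    {Ω' : Type w} [MeasurableSpace Ω'] {H : Type v} [NormedAddCommGroup H]
    [InnerProductSpace ℂ H] [CompleteSpace H] [Nontrivial H]
    (A : Set Ω → H →L[ℂ] H) (hA_discrete : QuantumObservable.IsDiscrete A)
    (hA_extreme : QuantumObservable.IsExtreme A)
    (B : Set Ω' → H →L[ℂ] H) (hB : QuantumObservable.IsObservable B) :
    QuantumObservable.Coexistent.{u, v, w, max u w x} A B ↔
      QuantumObservable.JointlyMeasurable A B :=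
  ⟨fun h => h.jointlyMeasurable hA_discrete hA_extreme hB, fun h => h.coexistent⟩

theorem corollary5p2p2014 {Ω : Type u} [MeasurableSpace Ω]
    {Ω' : Type w} [MeasurableSpace Ω'] {H : Type v} [NormedAddCommGroup H]
    [InnerProductSpace ℂ H] [CompleteSpace H] [TopologicalSpace.SeparableSpace H] [Nontrivial H]
    (A : Set Ω → H →L[ℂ] H) (hA : QuantumObservable.IsObservable A)
    (hA_discrete : QuantumObservable.IsDiscrete A)
    (hA_extreme : QuantumObservable.IsExtreme A)
    (B : Set Ω' → H →L[ℂ] H) (hB : QuantumObservable.IsObservable B) :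
    QuantumObservable.Coexistent.{u, v, w, max u w x} A B ↔
      QuantumObservable.JointlyMeasurable A B :=
  corollary5p2p2014_general A hA_discrete hA_extreme B hB
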